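/- Let $f\colon G\to H$ be a homomorphism of groups, where $G$ and $H$ are arbitrary (possibly infinite). For a topological space $X$, let $\mathrm{Aut}(X)$ be the group of homeomorphisms $X\to X$ under composition, let $\mathcal{E}(X)$ be the group of (free) homotopy classes of self-homotopy equivalences of $X$, with product $[a][b]=[a\circ b]$, and let $\tau_X\colon \mathrm{Aut}(X)\to\mathcal{E}(X)$, $\tau_X(a)=[a]$, be the natural homomorphism. Then there is a $T_0$ Alexandroff space $X_f$ (a $T_0$ topological space in which arbitrary intersections of open sets are open) together with group isomorphisms $\varphi\colon G\to \mathrm{Aut}(X_f)$ and $\psi\colon H\to\mathcal{E}(X_f)$ such that $\tau_{X_f}\circ\varphi=\psi\circ f$. -/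

import Mathlib

universe u v

/-- Two self-homotopy equivalences of `X` are identified when their underlying
continuous maps are (freely) homotopic. -/
def selfEquivSetoid (X : Type u) [TopologicalSpace X] :
    Setoid (ContinuousMap.HomotopyEquiv X X) where
  r a b := ContinuousMap.Homotopic a.toFun b.toFun
  iseqv :=
    { refl := fun a => ContinuousMap.Homotopic.refl a.toFun
      symm := fun h => h.symm
      trans := fun h k => h.trans k }

/-- `ℰ(X)`: the homotopy classes of self-homotopy equivalences of `X`. -/
def SelfEquivClasses (X : Type u) [TopologicalSpace X] : Type u :=
  Quotient (selfEquivSetoid X)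

namespace SelfEquivClasses

variable {X : Type u} [TopologicalSpace X]

/-- The homotopy class `[a]` of a self-homotopy equivalence `a`. -/
def mk (a : ContinuousMap.HomotopyEquiv X X) : SelfEquivClasses X :=
  Quotient.mk (selfEquivSetoid X) a

theorem mk_eq_mk_iff (a b : ContinuousMap.HomotopyEquiv X X) :
    mk a = mk b ↔ ContinuousMap.Homotopic a.toFun b.toFun :=
  Quotient.eq (r := selfEquivSetoid X)

/-- If `a` and `b` are homotopic homotopy equivalences, so are their homotopy inverses. -/
theorem homotopic_symm {a b : ContinuousMap.HomotopyEquiv X X}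
    (h : ContinuousMap.Homotopic a.toFun b.toFun) :
    ContinuousMap.Homotopic a.symm.toFun b.symm.toFun := by
  have h1 : ContinuousMap.Homotopic a.invFun ((b.invFun.comp b.toFun).comp a.invFun) :=
    (ContinuousMap.Homotopic.comp b.left_inv (ContinuousMap.Homotopic.refl a.invFun)).symm
  have h2 : ContinuousMap.Homotopic (b.invFun.comp (b.toFun.comp a.invFun))
      (b.invFun.comp (a.toFun.comp a.invFun)) :=
    ContinuousMap.Homotopic.comp (ContinuousMap.Homotopic.refl _)
      (ContinuousMap.Homotopic.comp h.symm (ContinuousMap.Homotopic.refl _))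
  have h3 : ContinuousMap.Homotopic (b.invFun.comp (a.toFun.comp a.invFun)) b.invFun :=
    ContinuousMap.Homotopic.comp (ContinuousMap.Homotopic.refl b.invFun) a.right_inv
  exact h1.trans (h2.trans h3)

/-- The group structure: `[a] * [b] = [a ∘ b]`, `1 = [id]`, and the inverse is the class of a
homotopy inverse. -/
instance : Group (SelfEquivClasses X) where
  mul := Quotient.map₂ (sa := selfEquivSetoid X) (sb := selfEquivSetoid X)
    (sc := selfEquivSetoid X) (fun a b => b.trans a)
    (fun _ _ h _ _ k => ContinuousMap.Homotopic.comp h k)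
  one := mk (ContinuousMap.HomotopyEquiv.refl X)
  inv := Quotient.map (sa := selfEquivSetoid X) (sb := selfEquivSetoid X)
    (fun a => a.symm) (fun _ _ h => homotopic_symm h)
  mul_assoc := by
    rintro ⟨a⟩ ⟨b⟩ ⟨c⟩
    exact (mk_eq_mk_iff _ _).2 (ContinuousMap.Homotopic.refl _)
  one_mul := by
    rintro ⟨a⟩
    exact (mk_eq_mk_iff _ _).2 (ContinuousMap.Homotopic.refl _)
  mul_one := by
    rintro ⟨a⟩
    exact (mk_eq_mk_iff _ _).2 (ContinuousMap.Homotopic.refl _)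
  inv_mul_cancel := by
    rintro ⟨a⟩
    exact (mk_eq_mk_iff _ _).2 a.left_inv

/-- The natural homomorphism `τ : Aut(X) → ℰ(X)` sending a homeomorphism to its homotopy class.
(`X ≃ₜ X` is a group under composition: `(a * b) x = a (b x)`.) -/
def ofHomeomorph (X : Type u) [TopologicalSpace X] : (X ≃ₜ X) →* SelfEquivClasses X where
  toFun a := mk a.toHomotopyEquiv
  map_one' := (mk_eq_mk_iff _ _).2 (ContinuousMap.Homotopic.refl _)
  map_mul' _ _ := (mk_eq_mk_iff _ _).2 (ContinuousMap.Homotopic.refl _)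

end SelfEquivClasses

/-!
Posets are regarded as spaces whose open sets are the upper sets; continuous maps are then the
monotone maps, homeomorphisms the order isomorphisms, and pointwise comparable maps are homotopic.
The space realizing `f : G → H` is a poset `X` collapsing onto a subposet `Y = Core H` such that

* `Aut(Y) ≅ H`, and every map `Y → Y` homotopic to the identity is the identity. Hence
  `ℰ(X) ≅ ℰ(Y) ≅ Aut(Y) ≅ H`;
* `Aut(X) ≅ G`, where `g : G` acts on `Y` as `f g`.

**The core.** Apart from five special points, `Y` consists of points `v k`, `e h t` and `l h` with
`h k : H` and `t` a label in `WithBot H`, where `H` carries an arbitrary well-order, unrelated to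
the group structure. The point `e h t` lies above `v k` exactly when `h⁻¹ * k ≤ t`, and below `l h`.
An automorphism maps the points below `l h` to the points below some `l h'`, inducing an
automorphism of the well-ordered set of labels. Such an automorphism is trivial, so all the
elements `h⁻¹ * k` are preserved, and the automorphism is a left translation
(`Core.exists_smul_of_orderIso`). The special points make the kinds of points distinguishable in
terms of the order, and put every point of `Y` into a finite subset `F` such that any monotone
self-map of `Y` comparable with the identity on `F` is the identity on `F`. For such an `F` the
times at which a homotopy starting at the identity fixes `F` form a clopen set
(`Topology.IsUpperSet.eq_self_of_homotopic_id`), whence the rigidity of `Y`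
(`Core.eq_id_of_homotopic_id`). Only finite sets `F` are involved, so the size of `Y` is irrelevant.

**The decoration.** `X` is the mapping cylinder of a monotone map `attach f : W → Y`, where
`W = Fibre G` has automorphism group `G` by the same labelling argument. Since `attach f` sends
`a k` to `l (f k)` and all other points of `W` to one fixed point, a pair of automorphisms, of `W`
and of `Y`, extends to `X` only if it is of the form `(g, f g)`
(`Realization.exists_smul_of_orderIso`). That automorphisms of `X` preserve the two parts follows
again from a description of these parts in terms of the order.
-/

open ContinuousMap

/-! ### Homotopy classes of self-equivalences -/

namespace SelfEquivClasses

/-- Conjugation by a homotopy equivalence `e : X ≃ₕ Y` identifies the groups of homotopy classes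
of self-homotopy equivalences of `X` and `Y`. -/
def congr {X : Type u} {Y : Type v} [TopologicalSpace X] [TopologicalSpace Y]
    (e : HomotopyEquiv X Y) : SelfEquivClasses X ≃* SelfEquivClasses Y where
  toFun := Quotient.map (sa := selfEquivSetoid X) (sb := selfEquivSetoid Y)
    (fun a => (e.symm.trans a).trans e)
    (fun _ _ h => .comp (.refl _) (.comp h (.refl _)))
  invFun := Quotient.map (sa := selfEquivSetoid Y) (sb := selfEquivSetoid X)
    (fun a => (e.trans a).trans e.symm)
    (fun _ _ h => .comp (.refl _) (.comp h (.refl _)))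
  left_inv := by
    rintro ⟨a⟩
    exact (mk_eq_mk_iff _ _).2
      (Homotopic.comp (g₀ := e.invFun.comp e.toFun) (g₁ := .id X)
        (f₀ := a.toFun.comp (e.invFun.comp e.toFun)) (f₁ := a.toFun.comp (.id X))
        e.left_inv (.comp (.refl _) e.left_inv))
  right_inv := by
    rintro ⟨a⟩
    exact (mk_eq_mk_iff _ _).2
      (Homotopic.comp (g₀ := e.toFun.comp e.invFun) (g₁ := .id Y)
        (f₀ := a.toFun.comp (e.toFun.comp e.invFun)) (f₁ := a.toFun.comp (.id Y))
        e.right_inv (.comp (.refl _) e.right_inv))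
  map_mul' := by
    rintro ⟨a⟩ ⟨b⟩
    exact (mk_eq_mk_iff _ _).2
      (Homotopic.comp (g₀ := e.toFun.comp a.toFun) (f₀ := b.toFun.comp e.invFun)
        (f₁ := (e.invFun.comp e.toFun).comp (b.toFun.comp e.invFun))
        (.refl _) (.comp (g₀ := .id X) (f₀ := b.toFun.comp e.invFun)
          e.left_inv.symm (.refl _)))

/-- If only the identity of `X` is homotopic to the identity, then every self-homotopy
equivalence of `X` is a homeomorphism and homotopic homeomorphisms are equal. -/
theorem ofHomeomorph_bijective {X : Type u} [TopologicalSpace X]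
    (hX : ∀ g : C(X, X), Homotopic (.id X) g → g = .id X) :
    Function.Bijective (ofHomeomorph X) := by
  constructor
  · rw [injective_iff_map_eq_one]
    intro a ha
    have h := hX _ ((mk_eq_mk_iff a.toHomotopyEquiv (.refl X)).1 ha).symm
    ext x
    exact DFunLike.congr_fun h x
  · rintro ⟨a⟩
    have h1 := hX _ a.left_inv.symm
    have h2 := hX _ a.right_inv.symm
    let α : X ≃ₜ X :=
      { toFun := a.toFun
        invFun := a.invFun
        left_inv := DFunLike.congr_fun h1
        right_inv := DFunLike.congr_fun h2
        continuous_toFun := a.toFun.continuous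
        continuous_invFun := a.invFun.continuous }
    exact ⟨α, (mk_eq_mk_iff α.toHomotopyEquiv a).2 (.refl _)⟩

end SelfEquivClasses

/-! ### Spaces with the upper set topology -/

namespace Topology.IsUpperSet

variable {P : Type u} {Q : Type v} [TopologicalSpace P] [TopologicalSpace Q]

theorem t0Space [PartialOrder P] [Topology.IsUpperSet P] : T0Space P :=
  ⟨fun _ _ h => le_antisymm (specializes_iff_le.1 h.specializes')
    (specializes_iff_le.1 h.specializes)⟩

theorem isOpen_Ici [Preorder P] [Topology.IsUpperSet P] (x : P) : IsOpen (Set.Ici x) :=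
  isOpen_iff_isUpperSet.2 (isUpperSet_Ici x)

/-- The homotopy is `f` at time `0` and `g` at all later times. -/
theorem homotopic_of_le [Preorder Q] [Topology.IsUpperSet Q] {f g : C(P, Q)}
    (h : ∀ x, f x ≤ g x) : Homotopic f g := by
  classical
  refine ⟨⟨⟨fun p => if p.1 = 0 then f p.2 else g p.2, ?_⟩, by simp, by simp⟩⟩
  rw [continuous_def]
  intro s hs
  have hup := isOpen_iff_isUpperSet.1 hs
  have : (fun p : unitInterval × P => if p.1 = 0 then f p.2 else g p.2) ⁻¹' s =
      Prod.snd ⁻¹' (f ⁻¹' s) ∪ (Prod.fst ⁻¹' {0}ᶜ ∩ Prod.snd ⁻¹' (g ⁻¹' s)) := by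
    ext ⟨t, x⟩
    by_cases ht : t = 0
    · simp [ht]
    · simpa [ht] using fun hx => hup (h x) hx
  rw [this]
  exact ((hs.preimage f.continuous).preimage continuous_snd).union
    ((isOpen_compl_singleton.preimage continuous_fst).inter
      ((hs.preimage g.continuous).preimage continuous_snd))

/-- A finite set `F` on which no monotone map other than the identity is comparable with the
identity stays fixed under every homotopy starting at the identity: the times at which `F` is
fixed pointwise form a clopen set. Finiteness makes the neighbourhoods of a time, obtained for
each point of `F` separately, intersect in a neighbourhood. -/
theorem eq_self_of_homotopic_id [Preorder P] [Topology.IsUpperSet P] {F : Set P} (hF : F.Finite)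
    (hle : ∀ j : P → P, Monotone j → (∀ x ∈ F, j x ≤ x) → ∀ x ∈ F, j x = x)
    (hge : ∀ j : P → P, Monotone j → (∀ x ∈ F, x ≤ j x) → ∀ x ∈ F, j x = x)
    {g : C(P, P)} (h : Homotopic (.id P) g) : ∀ x ∈ F, g x = x := by
  obtain ⟨K⟩ := h
  have hmono (t : unitInterval) : Monotone fun x => K (t, x) :=
    IsUpperSet.monotone_iff_continuous.2 (by fun_prop)
  have hnear (t : unitInterval) : ∀ᶠ s in nhds t, ∀ x ∈ F, K (t, x) ≤ K (s, x) := by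
    rw [Filter.eventually_all_finite hF]
    intro x _
    have hc : Continuous fun s : unitInterval => K (s, x) := by fun_prop
    exact hc.continuousAt.eventually ((isOpen_Ici (K (t, x))).mem_nhds le_rfl)
  have hclopen : IsClopen {t : unitInterval | ∀ x ∈ F, K (t, x) = x} := by
    constructor
    · rw [← closure_subset_iff_isClosed]
      intro t ht
      obtain ⟨s, hs, hsF⟩ := mem_closure_iff_nhds.1 ht _ (hnear t)
      exact hle _ (hmono t) fun x hx => (hs x hx).trans_eq (hsF x hx)
    · rw [isOpen_iff_mem_nhds]
      intro t ht
      filter_upwards [hnear t] with s hs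
      exact hge _ (hmono s) fun x hx => (ht x hx).symm.trans_le (hs x hx)
  have huniv := hclopen.eq_univ ⟨0, fun x _ => K.apply_zero x⟩
  intro x hx
  have h1 : (1 : unitInterval) ∈ {t : unitInterval | ∀ x ∈ F, K (t, x) = x} :=
    huniv ▸ Set.mem_univ _
  rw [← K.apply_one x]
  exact h1 x hx

/-- A homeomorphism between spaces with the upper set topology is an order isomorphism. -/
def orderIsoOfHomeomorph [Preorder P] [Preorder Q] [Topology.IsUpperSet P]
    [Topology.IsUpperSet Q] (α : P ≃ₜ Q) : P ≃o Q where
  toEquiv := α.toEquiv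
  map_rel_iff' {x y} :=
    ⟨fun h => by simpa using IsUpperSet.monotone_iff_continuous.2 α.symm.continuous h,
      fun h => IsUpperSet.monotone_iff_continuous.2 α.continuous h⟩

/-- An action by monotone maps, as a homomorphism to the homeomorphism group. -/
def smulHom {K : Type*} [Group K] [MulAction K P] [Preorder P] [Topology.IsUpperSet P]
    (h : ∀ k : K, Monotone fun x : P => k • x) : K →* (P ≃ₜ P) where
  toFun k :=
    { toEquiv := MulAction.toPerm k
      continuous_toFun := IsUpperSet.monotone_iff_continuous.1 (h k)
      continuous_invFun := IsUpperSet.monotone_iff_continuous.1 (h k⁻¹) }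
  map_one' := by ext x; exact one_smul K x
  map_mul' a b := by ext x; exact mul_smul a b x

end Topology.IsUpperSet

/-! ### A homotopically rigid poset with prescribed automorphism group -/

/-- The points of a poset of height two on which `H` acts. The group acts by left translation on
the indices in `H` of `v`, `e`, `l` and fixes the labels `t` and the five special points. The order
(see `Core.le`) records the well-ordered chain of sets `{k | h⁻¹ * k ≤ t}` for each `h : H`. -/
inductive Core (H : Type v) : Type v
  | b | c | d
  | v (k : H)
  | e (h : H) (t : WithBot H)
  | l (h : H)
  | top
  | u

namespace Core

variable {H : Type v} [Group H]

instance : MulAction H (Core H) where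
  smul g
    | b => b
    | c => c
    | d => d
    | v k => v (g * k)
    | e h t => e (g * h) t
    | l h => l (g * h)
    | top => top
    | u => u
  one_smul x := by cases x <;> simp [HSMul.hSMul]
  mul_smul g g' x := by cases x <;> simp [HSMul.hSMul, mul_assoc]

@[simp] theorem smul_v (g k : H) : g • v k = v (g * k) := rfl
@[simp] theorem smul_e (g h : H) (t : WithBot H) : g • e h t = e (g * h) t := rfl
@[simp] theorem smul_l (g h : H) : g • l h = l (g * h) := rfl
@[simp] theorem smul_b (g : H) : g • (b : Core H) = b := rfl
@[simp] theorem smul_c (g : H) : g • (c : Core H) = c := rfl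
@[simp] theorem smul_d (g : H) : g • (d : Core H) = d := rfl
@[simp] theorem smul_top (g : H) : g • (top : Core H) = top := rfl
@[simp] theorem smul_u (g : H) : g • (u : Core H) = u := rfl

variable [LinearOrder H]

/-- The order of `Core H`: the minimal points are `b`, `c`, `d` and the `v k`, the maximal points
are the `l h`, `top` and `u`, and the points `e h t` lie between. Below `e h t` lie `b`, `d` and
the `v k` with `h⁻¹ * k ≤ t`. -/
protected def le : Core H → Core H → Prop
  | b, x => x ≠ c ∧ x ≠ d ∧ ∀ k, x ≠ v k
  | c, x => x = c ∨ x = top ∨ x = u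
  | d, x => x = d ∨ x = top ∨ (∃ h t, x = e h t) ∨ ∃ h, x = l h
  | v k, v k' => k = k'
  | v k, e h t => ((h⁻¹ * k : H) : WithBot H) ≤ t
  | v _, l _ => True
  | v _, top => True
  | v _, u => True
  | e h t, e h' t' => h = h' ∧ t = t'
  | e h _, l h' => h = h'
  | e _ _, top => True
  | l h, l h' => h = h'
  | top, top => True
  | u, u => True
  | _, _ => False

instance : PartialOrder (Core H) where
  le := Core.le
  le_refl x := by cases x <;> simp [Core.le]
  le_trans x y z := by
    cases x <;> cases y <;> simp [Core.le] <;> cases z <;> simp <;> grind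
  le_antisymm x y := by cases x <;> cases y <;> simp [Core.le] <;> grind

theorem le_def {x y : Core H} : x ≤ y ↔ Core.le x y := Iff.rfl

theorem lt_def {x y : Core H} : x < y ↔ Core.le x y ∧ x ≠ y := lt_iff_le_and_ne

instance : TopologicalSpace (Core H) := Topology.upperSet (Core H)

instance : Topology.IsUpperSet (Core H) := ⟨rfl⟩

theorem smul_monotone (g : H) : Monotone fun x : Core H => g • x := by
  intro x y
  cases x <;> cases y <;> simp [le_def, Core.le, mul_assoc]

theorem isMin_iff {x : Core H} : IsMin x ↔ x = b ∨ x = c ∨ x = d ∨ ∃ k, x = v k := by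
  rw [isMin_iff_forall_not_lt]
  constructor
  · intro h
    have := h b
    cases x <;> simp_all [lt_def, Core.le]
  · rintro (rfl | rfl | rfl | ⟨k, rfl⟩) y <;> cases y <;> simp [lt_def, Core.le]

theorem isMax_iff {x : Core H} : IsMax x ↔ x = top ∨ x = u ∨ ∃ h, x = l h := by
  rw [isMax_iff_forall_not_lt]
  constructor
  · intro h
    have := h top
    cases x <;> simp_all [lt_def, Core.le]
  · rintro (rfl | rfl | ⟨k, rfl⟩) y <;> cases y <;> simp [lt_def, Core.le]

/-- Every point `x` lies in a finite set fixed by all monotone maps comparable with the identity: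
each of its minimal points lies below two others whose only common lower bound above it is the
point itself, each of its maximal points satisfies the dual condition, and each `e h t` lies
between two minimal and two maximal points separating it from everything else. -/
theorem eq_id_of_homotopic_id {g : C(Core H, Core H)} (hg : Homotopic (.id (Core H)) g) :
    g = .id (Core H) := by
  have key (h k : H) (t : WithBot H) :
      ∀ x ∈ ({b, c, d, v k, e h ⊥, e h (1 : H), e h t, l h, top, u} : Set (Core H)),
        g x = x := by
    apply Topology.IsUpperSet.eq_self_of_homotopic_id (Set.toFinite _) _ _ hg
    · intro j hj hF
      simp only [Set.mem_insert_iff, Set.mem_singleton_iff, forall_eq_or_imp, forall_eq] at hF ⊢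
      obtain ⟨hb, hc, hd, hv, he, he', het, hl, ht, hu⟩ := hF
      have hb := (isMin_iff.2 (by simp) : IsMin (b : Core H)).eq_of_le hb
      have hc := (isMin_iff.2 (by simp) : IsMin (c : Core H)).eq_of_le hc
      have hd := (isMin_iff.2 (by simp) : IsMin (d : Core H)).eq_of_le hd
      have hv := (isMin_iff.2 (by simp) : IsMin (v k)).eq_of_le hv
      have he_all (s) (hs : j (e h s) ≤ e h s) : j (e h s) = e h s := by
        have h1 : b ≤ j (e h s) := hb ▸ hj (by simp [le_def, Core.le])
        have h2 : d ≤ j (e h s) := hd ▸ hj (by simp [le_def, Core.le])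
        revert h1 h2 hs
        cases j (e h s) <;> simp [le_def, Core.le]
      have he := he_all _ he
      have he' := he_all _ he'
      refine ⟨hb, hc, hd, hv, he, he', he_all _ het, ?_, ?_, ?_⟩
      · have h1 : e h ⊥ ≤ j (l h) := he ▸ hj (by simp [le_def, Core.le])
        have h2 : e h (1 : H) ≤ j (l h) := he' ▸ hj (by simp [le_def, Core.le])
        revert h1 h2 hl
        cases j (l h) <;> simp [le_def, Core.le] <;> grind [WithBot.coe_ne_bot, WithBot.coe_one]
      · have h1 : b ≤ j top := hb ▸ hj (by simp [le_def, Core.le])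
        have h2 : c ≤ j top := hc ▸ hj (by simp [le_def, Core.le])
        revert h1 h2 ht
        cases j top <;> simp [le_def, Core.le]
      · have h1 : b ≤ j u := hb ▸ hj (by simp [le_def, Core.le])
        have h2 : c ≤ j u := hc ▸ hj (by simp [le_def, Core.le])
        revert h1 h2 hu
        cases j u <;> simp [le_def, Core.le]
    · intro j hj hF
      simp only [Set.mem_insert_iff, Set.mem_singleton_iff, forall_eq_or_imp, forall_eq] at hF ⊢
      obtain ⟨hb, hc, hd, hv, he, he', het, hl, ht, hu⟩ := hF
      have hl := (isMax_iff.2 (by simp) : IsMax (l h)).eq_of_ge hl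
      have ht := (isMax_iff.2 (by simp) : IsMax (top : Core H)).eq_of_ge ht
      have hu := (isMax_iff.2 (by simp) : IsMax (u : Core H)).eq_of_ge hu
      have he_all (s) (hs : e h s ≤ j (e h s)) : j (e h s) = e h s := by
        have h1 : j (e h s) ≤ l h := hl ▸ hj (by simp [le_def, Core.le])
        have h2 : j (e h s) ≤ top := ht ▸ hj (by simp [le_def, Core.le])
        revert h1 h2 hs
        cases j (e h s) <;> simp [le_def, Core.le]; grind
      have he := he_all _ he
      have he' := he_all _ he'
      refine ⟨?_, ?_, ?_, ?_, he, he', he_all _ het, hl, ht, hu⟩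
      · have h1 : j b ≤ u := hu ▸ hj (by simp [le_def, Core.le])
        have h2 : j b ≤ top := ht ▸ hj (by simp [le_def, Core.le])
        revert h1 h2 hb
        cases j b <;> simp [le_def, Core.le]
      · have h1 : j c ≤ u := hu ▸ hj (by simp [le_def, Core.le])
        have h2 : j c ≤ top := ht ▸ hj (by simp [le_def, Core.le])
        revert h1 h2 hc
        cases j c <;> simp [le_def, Core.le]
      · have h1 : j d ≤ e h ⊥ := he ▸ hj (by simp [le_def, Core.le])
        have h2 : j d ≤ e h (1 : H) := he' ▸ hj (by simp [le_def, Core.le])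
        revert h1 h2 hd
        cases j d <;> simp [le_def, Core.le]; grind [WithBot.coe_ne_bot, WithBot.coe_one]
      · have h1 : j (v k) ≤ u := hu ▸ hj (by simp [le_def, Core.le])
        have h2 : j (v k) ≤ top := ht ▸ hj (by simp [le_def, Core.le])
        revert h1 h2 hv
        cases j (v k) <;> simp [le_def, Core.le, eq_comm]
  ext x
  rw [ContinuousMap.id_apply]
  cases x with
  | v k => exact key 1 k ⊥ _ (by simp)
  | e h t => exact key h 1 t _ (by simp)
  | l h => exact key h 1 ⊥ _ (by simp)
  | _ => exact key 1 1 ⊥ _ (by simp)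

end Core

/-! ### Order-theoretic recognition of special points -/

theorem StrictMono.eq_id_of_surjective {L : Type*} [LinearOrder L] [WellFoundedLT L] {τ : L → L}
    (hτ : StrictMono τ) (hs : Function.Surjective τ) : τ = id :=
  congrArg (fun f : L ≃o L => (f : L → L))
    (Subsingleton.elim (hτ.orderIsoOfSurjective τ hs) (OrderIso.refl L))

section Recognition

variable {P : Type u} {Q : Type v} [PartialOrder P] [PartialOrder Q]

/-- A minimal point all of whose strict upper bounds are maximal. In the posets below this
describes the point `c`. -/
def IsFlatMin (x : P) : Prop := IsMin x ∧ ∀ y, x < y → IsMax y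

/-- A point above a flat minimal point, with only minimal points strictly below it. In the posets
below this describes the point `u`. -/
def IsFlatMax (x : P) : Prop := (∃ z, IsFlatMin z ∧ z < x) ∧ ∀ y, y < x → IsMin y

/-- A point above a flat minimal point, with some non-minimal point strictly below it. In the
posets below this describes the point `top`. -/
def IsTallMax (x : P) : Prop := (∃ z, IsFlatMin z ∧ z < x) ∧ ∃ y, y < x ∧ ¬ IsMin y

theorem OrderIso.isFlatMin_apply (α : P ≃o Q) {x : P} : IsFlatMin (α x) ↔ IsFlatMin x := by
  simp [IsFlatMin, α.surjective.forall, α.isMin_apply, α.isMax_apply]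

theorem OrderIso.isFlatMax_apply (α : P ≃o Q) {x : P} : IsFlatMax (α x) ↔ IsFlatMax x := by
  simp [IsFlatMax, α.surjective.forall, α.surjective.exists, α.isFlatMin_apply, α.isMin_apply]

theorem OrderIso.isTallMax_apply (α : P ≃o Q) {x : P} : IsTallMax (α x) ↔ IsTallMax x := by
  simp [IsTallMax, α.surjective.exists, α.isFlatMin_apply]

end Recognition

namespace Core

variable {H : Type v} [Group H] [LinearOrder H]

theorem isFlatMin_iff {x : Core H} : IsFlatMin x ↔ x = c := by
  constructor
  · rintro ⟨hx, h⟩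
    have hb (y : Core H) (hy : x < y) := isMax_iff.1 (h y hy)
    rcases isMin_iff.1 hx with rfl | rfl | rfl | ⟨k, rfl⟩
    · simpa [lt_def, Core.le] using hb (e 1 ⊥)
    · rfl
    · simpa [lt_def, Core.le] using hb (e 1 ⊥)
    · simpa [lt_def, Core.le] using hb (e k (1 : H))
  · rintro rfl
    refine ⟨isMin_iff.2 (by simp), fun y => ?_⟩
    rw [isMax_iff]
    cases y <;> simp [lt_def, Core.le]

theorem isFlatMax_iff {x : Core H} : IsFlatMax x ↔ x = u := by
  constructor
  · rintro ⟨⟨z, hz, hzx⟩, h⟩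
    rw [isFlatMin_iff] at hz
    have := h (e 1 ⊥)
    rw [isMin_iff] at this
    subst hz
    cases x <;> simp_all [lt_def, Core.le]
  · rintro rfl
    refine ⟨⟨c, isFlatMin_iff.2 rfl, by simp [lt_def, Core.le]⟩, fun y => ?_⟩
    rw [isMin_iff]
    cases y <;> simp [lt_def, Core.le]

theorem isTallMax_iff {x : Core H} : IsTallMax x ↔ x = top := by
  constructor
  · rintro ⟨⟨z, hz, hzx⟩, y, hyx, hy⟩
    rw [isFlatMin_iff] at hz
    rw [isMin_iff] at hy
    subst hz
    cases x <;> cases y <;> simp_all [lt_def, Core.le]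
  · rintro rfl
    exact ⟨⟨c, isFlatMin_iff.2 rfl, by simp [lt_def, Core.le]⟩, e 1 ⊥,
      by simp [lt_def, Core.le], by simp [isMin_iff]⟩

theorem exists_eq_e_iff {x : Core H} : (∃ h t, x = e h t) ↔ x < top ∧ ¬ IsMin x := by
  rw [isMin_iff]
  cases x <;> simp [lt_def, Core.le]

theorem exists_eq_l_iff {x : Core H} : (∃ h, x = l h) ↔ IsMax x ∧ x ≠ top ∧ x ≠ u := by
  rw [isMax_iff]
  cases x <;> simp

theorem eq_d_iff {x : Core H} : x = d ↔ IsMin x ∧ ¬ x < u := by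
  rw [isMin_iff]
  cases x <;> simp [lt_def, Core.le]

theorem eq_b_iff {x : Core H} :
    x = b ↔ IsMin x ∧ x < u ∧ ∀ y, y < top ∧ ¬ IsMin y → x < y := by
  simp_rw [← exists_eq_e_iff]
  rw [isMin_iff]
  constructor
  · rintro rfl
    refine ⟨by simp, by simp [lt_def, Core.le], ?_⟩
    rintro _ ⟨h, t, rfl⟩
    simp [lt_def, Core.le]
  · rintro ⟨h1, h2, h3⟩
    have := h3 (e 1 ⊥) ⟨1, ⊥, rfl⟩
    cases x <;> simp_all [lt_def, Core.le]

theorem exists_eq_v_iff {x : Core H} :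
    (∃ k, x = v k) ↔ IsMin x ∧ x ≠ b ∧ x ≠ c ∧ x ≠ d := by
  rw [isMin_iff]
  cases x <;> simp

/-- Every automorphism of `Core H` is the action of an element of `H`. An automorphism permutes
each of the four kinds of points; on the labels of the points `e h _` it is an automorphism of a
well-order, hence trivial, so it preserves all the values `h⁻¹ * k`. -/
theorem exists_smul_of_orderIso [WellFoundedLT H] (α : Core H ≃o Core H) :
    ∃ g : H, ∀ x, α x = g • x := by
  have hc (β : Core H ≃o Core H) : β c = c :=
    isFlatMin_iff.1 (β.isFlatMin_apply.2 (isFlatMin_iff.2 rfl))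
  have hu (β : Core H ≃o Core H) : β u = u :=
    isFlatMax_iff.1 (β.isFlatMax_apply.2 (isFlatMax_iff.2 rfl))
  have htop (β : Core H ≃o Core H) : β top = top :=
    isTallMax_iff.1 (β.isTallMax_apply.2 (isTallMax_iff.2 rfl))
  have hlt_u (β : Core H ≃o Core H) (x) : β x < u ↔ x < u := by
    conv_lhs => rw [← hu β, β.lt_iff_lt]
  have hlt_top (β : Core H ≃o Core H) (x) : β x < top ↔ x < top := by
    conv_lhs => rw [← htop β, β.lt_iff_lt]
  have hd (β : Core H ≃o Core H) : β d = d := by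
    rw [eq_d_iff, β.isMin_apply, hlt_u, ← eq_d_iff]
  have hb (β : Core H ≃o Core H) : β b = b := by
    rw [eq_b_iff, β.isMin_apply, β.surjective.forall, hlt_u]
    simp_rw [hlt_top, β.lt_iff_lt, β.isMin_apply]
    rw [← eq_b_iff]
  have he (β : Core H ≃o Core H) (h : H) (t) : ∃ h' t', β (e h t) = e h' t' := by
    rw [exists_eq_e_iff, β.isMin_apply, hlt_top, ← exists_eq_e_iff]
    exact ⟨h, t, rfl⟩
  have hl (β : Core H ≃o Core H) (h : H) : ∃ h', β (l h) = l h' := by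
    rw [exists_eq_l_iff, β.isMax_apply]
    refine ⟨isMax_iff.2 (by simp), ?_, ?_⟩
    · rw [← htop β, β.injective.ne_iff]; simp
    · rw [← hu β, β.injective.ne_iff]; simp
  have hv (β : Core H ≃o Core H) (k : H) : ∃ k', β (v k) = v k' := by
    rw [exists_eq_v_iff, β.isMin_apply]
    refine ⟨isMin_iff.2 (by simp), ?_, ?_, ?_⟩
    · rw [← hb β, β.injective.ne_iff]; simp
    · rw [← hc β, β.injective.ne_iff]; simp
    · rw [← hd β, β.injective.ne_iff]; simp
  choose γ hγ using hl α
  choose σ hσ using hv α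
  have hτ_ex (h : H) (t) : ∃ t', α (e h t) = e (γ h) t' := by
    obtain ⟨h', t', h1⟩ := he α h t
    have h2 : e h t ≤ l h := by simp [le_def, Core.le]
    rw [← α.le_iff_le, h1, hγ] at h2
    obtain rfl : h' = γ h := by simpa [le_def, Core.le] using h2
    exact ⟨t', h1⟩
  choose τ hτ using hτ_ex
  have hσ_surj : Function.Surjective σ := by
    intro k
    obtain ⟨k', h1⟩ := hv α.symm k
    refine ⟨k', ?_⟩
    have h2 : v k = v (σ k') := by rw [← hσ, ← h1, α.apply_symm_apply]
    simpa using h2.symm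
  have hτ_surj (h : H) : Function.Surjective (τ h) := by
    intro t
    obtain ⟨h', t', h1⟩ := he α.symm (γ h) t
    have h2 : e (γ h) t = e (γ h') (τ h' t') := by rw [← hτ, ← h1, α.apply_symm_apply]
    obtain ⟨h3, h4⟩ : γ h = γ h' ∧ t = τ h' t' := by simpa using h2
    have h5 : l h = l h' := α.injective (by rw [hγ, hγ, h3])
    obtain rfl : h = h' := by simpa using h5
    exact ⟨t', h4.symm⟩
  have hle (h k : H) (t) : ((h⁻¹ * k : H) : WithBot H) ≤ t ↔
      (((γ h)⁻¹ * σ k : H) : WithBot H) ≤ τ h t := by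
    have h1 := α.le_iff_le (x := v k) (y := e h t)
    rw [hσ, hτ] at h1
    simpa [le_def, Core.le] using h1.symm
  have hτ_id (h : H) : τ h = id := by
    refine StrictMono.eq_id_of_surjective (Monotone.strictMono_of_injective ?_ ?_) (hτ_surj h)
    · intro t₁ t₂ ht
      by_contra! hlt
      obtain ⟨s, hs⟩ := WithBot.ne_bot_iff_exists.1 (bot_le.trans_lt hlt).ne'
      obtain ⟨k, hk⟩ := hσ_surj (γ h * s)
      have hk' : (γ h)⁻¹ * σ k = s := by rw [hk, inv_mul_cancel_left]
      have h1 := (hle h k t₁).2 (by rw [hk', hs])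
      have h2 := (hle h k t₂).1 (h1.trans ht)
      rw [hk', hs] at h2
      exact h2.not_gt hlt
    · intro t₁ t₂ ht
      have h1 : e h t₁ = e h t₂ := α.injective (by rw [hτ, hτ, ht])
      simpa using h1
  have heq (h k : H) : h⁻¹ * k = (γ h)⁻¹ * σ k := by
    have h1 := eq_of_forall_ge_iff fun t => by simpa [hτ_id] using hle h k t
    exact_mod_cast h1
  have hγσ (h : H) : γ h = σ h := by simpa [eq_comm, inv_mul_eq_one] using heq h h
  have hσ_eq (k : H) : σ k = σ 1 * k := by
    have h1 := heq 1 k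
    rw [hγσ] at h1
    rw [eq_inv_mul_iff_mul_eq] at h1
    simpa using h1.symm
  refine ⟨σ 1, fun x => ?_⟩
  cases x with
  | b => exact hb α
  | c => exact hc α
  | d => exact hd α
  | top => exact htop α
  | u => exact hu α
  | v k => rw [hσ, smul_v, hσ_eq]
  | l h => rw [hγ, smul_l, hγσ, hσ_eq]
  | e h t => rw [hτ, smul_e, hγσ, hσ_eq, hτ_id, id]

end Core

/-! ### Mapping cylinders of monotone maps -/

/-- The points of the mapping cylinder of `r : W → Y`: the disjoint union of `Y` and `W`. -/
inductive Cyl {W : Type u} {Y : Type v} (r : W → Y) : Type (max u v)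
  | base (y : Y)
  | fib (w : W)

namespace Cyl

/-- The order of the mapping cylinder: `Y` and `W` keep their orders, and `y` lies below `w` if
and only if `y ≤ r w`. -/
protected def le {W : Type u} {Y : Type v} [LE W] [LE Y] (r : W → Y) : Cyl r → Cyl r → Prop
  | base y, base y' => y ≤ y'
  | base y, fib w => y ≤ r w
  | fib _, base _ => False
  | fib w, fib w' => w ≤ w'

variable {W : Type u} {Y : Type v} [PartialOrder W] [PartialOrder Y] {r : W →o Y}

instance : PartialOrder (Cyl r) where
  le := Cyl.le r
  le_refl x := by cases x <;> simp [Cyl.le]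
  le_trans x y z := by
    rcases x with x | x <;> rcases y with y | y <;> rcases z with z | z <;>
      simp only [Cyl.le, false_imp_iff, imp_self, implies_true]
    · exact le_trans
    · exact le_trans
    · exact fun h h' => h.trans (r.monotone h')
    · exact le_trans
  le_antisymm x y := by
    rcases x with x | x <;> rcases y with y | y <;>
      simp only [Cyl.le, base.injEq, fib.injEq, false_imp_iff, implies_true]
    · exact le_antisymm
    · exact le_antisymm

@[simp] theorem base_le_base {y y' : Y} : (base y : Cyl r) ≤ base y' ↔ y ≤ y' := Iff.rfl
@[simp] theorem base_le_fib {y : Y} {w : W} : (base y : Cyl r) ≤ fib w ↔ y ≤ r w := Iff.rfl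
@[simp] theorem not_fib_le_base {y : Y} {w : W} : ¬ (fib w : Cyl r) ≤ base y := id
@[simp] theorem fib_le_fib {w w' : W} : (fib w : Cyl r) ≤ fib w' ↔ w ≤ w' := Iff.rfl

@[simp] theorem base_lt_base {y y' : Y} : (base y : Cyl r) < base y' ↔ y < y' := by
  simp [lt_iff_le_not_ge]

@[simp] theorem base_lt_fib {y : Y} {w : W} : (base y : Cyl r) < fib w ↔ y ≤ r w := by
  simp [lt_iff_le_not_ge]

@[simp] theorem not_fib_lt_base {y : Y} {w : W} : ¬ (fib w : Cyl r) < base y :=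
  fun h => not_fib_le_base h.le

@[simp] theorem isMin_base {y : Y} : IsMin (base y : Cyl r) ↔ IsMin y := by
  constructor
  · intro h z hz
    exact h (b := base z) hz
  · rintro h (z | w) hz
    · exact h hz
    · exact hz.elim

@[simp] theorem not_isMin_fib {w : W} : ¬ IsMin (fib w : Cyl r) :=
  fun h => not_fib_le_base (h (b := base (r w)) (base_le_fib.2 le_rfl))

instance : TopologicalSpace (Cyl r) := Topology.upperSet (Cyl r)

instance : Topology.IsUpperSet (Cyl r) := ⟨rfl⟩

/-- The mapping cylinder collapses onto its base by `r`. -/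
def homotopyEquivBase [TopologicalSpace Y] [Topology.IsUpperSet Y] : HomotopyEquiv Y (Cyl r) where
  toFun := ⟨base, Topology.IsUpperSet.monotone_iff_continuous.1 fun _ _ h => h⟩
  invFun := ⟨fun | base y => y | fib w => r w, by
    refine Topology.IsUpperSet.monotone_iff_continuous.1 ?_
    rintro (x | x) (y | y) h
    · exact h
    · exact h
    · exact h.elim
    · exact r.monotone h⟩
  left_inv := .refl _
  right_inv := Topology.IsUpperSet.homotopic_of_le <| by
    rintro (x | x)
    · exact le_rfl
    · exact base_le_fib.2 le_rfl

end Cyl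

/-! ### The decoration recording `G` -/

/-- The points of a poset on which `G` acts by left translation on `k` and `g`, fixing the
labels `t`. -/
inductive Fibre (G : Type u) : Type u
  | a (k : G)
  | c (g t : G)

namespace Fibre

variable {G : Type u} [Group G]

instance : MulAction G (Fibre G) where
  smul g
    | a k => a (g * k)
    | c h t => c (g * h) t
  one_smul x := by cases x <;> simp [HSMul.hSMul]
  mul_smul g g' x := by cases x <;> simp [HSMul.hSMul, mul_assoc]

@[simp] theorem smul_a (g k : G) : g • a k = a (g * k) := rfl
@[simp] theorem smul_c (g h t : G) : g • c h t = c (g * h) t := rfl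

variable [LinearOrder G]

/-- The order of `Fibre G`: for each `g` the points `c g t` form a chain, and `c g t` lies below
the maximal point `a k` if and only if `t ≤ g⁻¹ * k`. -/
protected def le : Fibre G → Fibre G → Prop
  | a k, a k' => k = k'
  | a _, c _ _ => False
  | c g t, a k => t ≤ g⁻¹ * k
  | c g s, c g' t => g = g' ∧ s ≤ t

instance : PartialOrder (Fibre G) where
  le := Fibre.le
  le_refl x := by cases x <;> simp [Fibre.le]
  le_trans x y z := by cases x <;> cases y <;> cases z <;> simp [Fibre.le] <;> grind
  le_antisymm x y := by cases x <;> cases y <;> simp [Fibre.le] <;> grind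

@[simp] theorem c_le_a {k g t : G} : c g t ≤ a k ↔ t ≤ g⁻¹ * k := Iff.rfl
@[simp] theorem c_le_c {g g' s t : G} : c g s ≤ c g' t ↔ g = g' ∧ s ≤ t := Iff.rfl

theorem smul_monotone (g : G) : Monotone fun x : Fibre G => g • x := by
  rintro (k | ⟨h, s⟩) (k' | ⟨h', t⟩) hx
  · exact congrArg (g * ·) hx
  · exact hx.elim
  · simpa [mul_assoc] using hx
  · simpa using hx

/-- Every automorphism of `Fibre G` is the action of an element of `G`. -/
theorem exists_smul_of_orderIso [WellFoundedLT G] (α : Fibre G ≃o Fibre G) :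
    ∃ g : G, ∀ x, α x = g • x := by
  have ha_iff (x : Fibre G) : (∃ k, x = a k) ↔ IsMax x := by
    constructor
    · rintro ⟨k, rfl⟩ (k' | ⟨g, t⟩) hx
      · exact (congrArg a hx).ge
      · exact hx.elim
    · intro h
      rcases x with k | ⟨g, t⟩
      · exact ⟨k, rfl⟩
      · exact (h (b := a (g * t)) (by simp)).elim
  have ha (β : Fibre G ≃o Fibre G) (k) : ∃ k', β (a k) = a k' := by
    rw [ha_iff, β.isMax_apply, ← ha_iff]
    exact ⟨k, rfl⟩
  have hc (β : Fibre G ≃o Fibre G) (g t) : ∃ g' t', β (c g t) = c g' t' := by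
    rcases hx : β (c g t) with k | ⟨g', t'⟩
    · have := (ha_iff _).1 ⟨k, hx⟩
      rw [β.isMax_apply, ← ha_iff] at this
      simp at this
    · exact ⟨g', t', rfl⟩
  choose σ hσ using ha α
  choose γ' τ hγ' using hc α
  have hγ_const (g s t) : γ' g s = γ' g t := by
    have key {s t : G} (h : s ≤ t) : γ' g s = γ' g t := by
      have h1 : c g s ≤ c g t := ⟨rfl, h⟩
      rw [← α.le_iff_le, hγ', hγ'] at h1
      exact h1.1
    rcases le_total s t with h | h
    · exact key h
    · exact (key h).symm
  obtain ⟨γ, hγ⟩ : ∃ γ : G → G, ∀ g t, α (c g t) = c (γ g) (τ g t) :=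
    ⟨fun g => γ' g 1, fun g t => by rw [hγ', hγ_const g t 1]⟩
  have hτ_id (g : G) : τ g = id := by
    have hle (s t : G) : τ g s ≤ τ g t ↔ s ≤ t := by
      have h1 := α.le_iff_le (x := c g s) (y := c g t)
      simpa [hγ] using h1
    refine StrictMono.eq_id_of_surjective (strictMono_of_le_iff_le fun s t => (hle s t).symm) ?_
    intro t
    obtain ⟨g', t', h1⟩ := hc α.symm (γ g) t
    have h2 : c (γ g) t = c (γ g') (τ g' t') := by rw [← hγ, ← h1, α.apply_symm_apply]
    obtain ⟨h3, h4⟩ : γ g = γ g' ∧ t = τ g' t' := by simpa using h2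
    -- Points of different chains are incomparable, so `γ` is injective.
    have h5 : g = g' := by
      rcases le_total (τ g 1) (τ g' 1) with h | h
      · have h6 : α (c g 1) ≤ α (c g' 1) := by rw [hγ, hγ, h3]; exact ⟨rfl, h⟩
        exact (α.le_iff_le.1 h6).1
      · have h6 : α (c g' 1) ≤ α (c g 1) := by rw [hγ, hγ, h3]; exact ⟨rfl, h⟩
        exact (α.le_iff_le.1 h6).1.symm
    subst h5
    exact ⟨t', h4.symm⟩
  have heq (g k : G) : g⁻¹ * k = (γ g)⁻¹ * σ k :=
    eq_of_forall_le_iff fun t => by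
      have h1 := α.le_iff_le (x := c g t) (y := a k)
      simpa [hγ, hσ, hτ_id] using h1.symm
  have hγσ (h : G) : γ h = σ h := by simpa [eq_comm, inv_mul_eq_one] using heq h h
  have hσ_eq (k : G) : σ k = σ 1 * k := by
    have h1 := heq 1 k
    rw [hγσ, eq_inv_mul_iff_mul_eq] at h1
    simpa using h1.symm
  refine ⟨σ 1, fun x => ?_⟩
  rcases x with k | ⟨g, t⟩
  · rw [hσ, smul_a, hσ_eq]
  · rw [hγ, smul_c, hγσ, hσ_eq, hτ_id, id]

end Fibre

/-! ### The space attached to a homomorphism -/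

section Realization

variable {G : Type u} {H : Type v} [Group G] [Group H] [LinearOrder G] [LinearOrder H]

/-- The map along which `Fibre G` is attached to `Core H`. Only the points `a k` remember `f`. -/
def attach (f : G →* H) : Fibre G →o Core H where
  toFun
    | .a k => .l (f k)
    | .c _ _ => .d
  monotone' := by
    rintro (k | ⟨h, s⟩) (k' | ⟨h', t⟩) hx
    · exact (congrArg (fun k => Core.l (f k)) hx).le
    · exact hx.elim
    · simp [Core.le_def, Core.le]
    · exact le_rfl

/-- The poset realizing `f`. -/
abbrev Realization (f : G →* H) : Type (max u v) := Cyl (attach f)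

namespace Realization

open Cyl

variable {f : G →* H}

@[simp] theorem attach_a (k : G) : attach f (.a k) = .l (f k) := rfl
@[simp] theorem attach_c (g t : G) : attach f (.c g t) = .d := rfl

instance : MulAction G (Realization f) where
  smul g
    | base y => base (f g • y)
    | fib w => fib (g • w)
  one_smul
    | base y => congrArg base (by rw [map_one, one_smul])
    | fib w => congrArg fib (one_smul G w)
  mul_smul
    | g, g', base y => congrArg base (by rw [map_mul, mul_smul])
    | g, g', fib w => congrArg fib (mul_smul g g' w)

theorem smul_base (g : G) (y : Core H) : g • (base y : Realization f) = base (f g • y) := rfl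
theorem smul_fib (g : G) (w : Fibre G) : g • (fib w : Realization f) = fib (g • w) := rfl

theorem attach_smul (g : G) (w : Fibre G) : attach f (g • w) = f g • attach f w := by
  cases w <;> simp

theorem smul_monotone (g : G) : Monotone fun x : Realization f => g • x := by
  rintro (x | x) (y | y) h
  · exact Core.smul_monotone (f g) h
  · simp only [smul_base, smul_fib, base_le_fib, attach_smul]
    exact Core.smul_monotone (f g) h
  · exact h.elim
  · exact Fibre.smul_monotone g h

theorem isFlatMin_iff {x : Realization f} : IsFlatMin x ↔ x = base .c := by
  constructor
  · rintro ⟨hx, h⟩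
    rcases x with x | x
    · rw [← Core.isFlatMin_iff.1 ⟨isMin_base.1 hx, fun y hy z hz =>
        h (base y) (base_lt_base.2 hy) (b := base z) hz⟩]
    · exact absurd hx not_isMin_fib
  · rintro rfl
    have hc := Core.isFlatMin_iff.2 (rfl : (Core.c : Core H) = .c)
    refine ⟨isMin_base.2 hc.1, ?_⟩
    rintro (y | k | ⟨g, t⟩) hy
    · have hy := base_lt_base.1 hy
      rintro (z | k | ⟨g, t⟩) hz
      · exact hc.2 y hy hz
      all_goals
        exfalso
        revert hy hz
        cases y <;> simp [Core.lt_def, Core.le_def, Core.le]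
    all_goals simp [Core.le_def, Core.le] at hy

theorem isFlatMax_iff {x : Realization f} : IsFlatMax x ↔ x = base .u := by
  simp only [IsFlatMax, isFlatMin_iff, exists_eq_left]
  rcases x with x | k | ⟨g, t⟩
  · rw [base_lt_base, base.injEq, ← Core.isFlatMax_iff]
    simp only [IsFlatMax, Core.isFlatMin_iff, exists_eq_left]
    refine and_congr_right fun _ => ⟨fun h y hy => ?_, ?_⟩
    · exact isMin_base.1 (h (base y) (base_lt_base.2 hy))
    · rintro h (y | y) hy
      · exact isMin_base.2 (h y (base_lt_base.1 hy))
      · exact absurd hy not_fib_lt_base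
  all_goals simp [Core.le_def, Core.le]

theorem isTallMax_iff {x : Realization f} : IsTallMax x ↔ x = base .top := by
  simp only [IsTallMax, isFlatMin_iff, exists_eq_left]
  rcases x with x | k | ⟨g, t⟩
  · rw [base_lt_base, base.injEq, ← Core.isTallMax_iff]
    simp only [IsTallMax, Core.isFlatMin_iff, exists_eq_left]
    refine and_congr_right fun _ => ⟨?_, ?_⟩
    · rintro ⟨y | y, hy, h⟩
      · exact ⟨y, base_lt_base.1 hy, fun h' => h (isMin_base.2 h')⟩
      · exact absurd hy not_fib_lt_base
    · rintro ⟨y, hy, h⟩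
      exact ⟨base y, base_lt_base.2 hy, fun h' => h (isMin_base.1 h')⟩
  all_goals simp [Core.le_def, Core.le]

/-- The points of `Fibre G` are those above some `c g t`, and `c g t` is not below `top` and has
only the minimal point `d` below it, which is not below `u`. In contrast, every point of the base
not below `top` lies above `b`, which is below `u`. -/
theorem exists_eq_fib_iff {x : Realization f} : (∃ w, x = fib w) ↔
    ∃ z ≤ x, ¬ z ≤ base .top ∧ ∀ m ≤ z, IsMin m → ¬ m < base .u := by
  constructor
  · have hc (g t : G) : ¬ (fib (.c g t) : Realization f) ≤ base .top ∧
        ∀ m ≤ (fib (.c g t) : Realization f), IsMin m → ¬ m < base .u := by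
      refine ⟨not_fib_le_base, ?_⟩
      rintro (m | m) hm _
      · revert hm
        cases m <;> simp [Core.lt_def, Core.le_def, Core.le]
      · exact not_fib_lt_base
    rintro ⟨k | ⟨g, t⟩, rfl⟩
    · exact ⟨fib (.c 1 k), by simp, hc _ _⟩
    · exact ⟨fib (.c g t), le_rfl, hc _ _⟩
  · rintro ⟨z, hzx, hz, hm⟩
    rcases x with x | w
    · rcases z with z | z
      · exfalso
        have hb : ¬ Core.b ≤ z := fun h =>
          hm (base .b) h (isMin_base.2 (Core.isMin_iff.2 (by simp)))
            (by simp [Core.lt_def, Core.le])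
        rw [base_le_base] at hz
        revert hb hz
        cases z <;> simp [Core.le_def, Core.le]
      · exact hzx.elim
    · exact ⟨w, rfl⟩

/-- Every automorphism of the realization is the action of an element of `G`: it restricts to
automorphisms of `Core H` and `Fibre G`, and the points `l (f k)`, `a k` tie the two together. -/
theorem exists_smul_of_orderIso [WellFoundedLT G] [WellFoundedLT H]
    (α : Realization f ≃o Realization f) : ∃ g : G, ∀ x, α x = g • x := by
  have hu (β : Realization f ≃o Realization f) : β (base .u) = base .u :=
    isFlatMax_iff.1 (β.isFlatMax_apply.2 (isFlatMax_iff.2 rfl))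
  have htop (β : Realization f ≃o Realization f) : β (base .top) = base .top :=
    isTallMax_iff.1 (β.isTallMax_apply.2 (isTallMax_iff.2 rfl))
  have hle_top (β : Realization f ≃o Realization f) (z) : β z ≤ base .top ↔ z ≤ base .top := by
    conv_lhs => rw [← htop β, β.le_iff_le]
  have hlt_u (β : Realization f ≃o Realization f) (z) : β z < base .u ↔ z < base .u := by
    conv_lhs => rw [← hu β, β.lt_iff_lt]
  have hfib (β : Realization f ≃o Realization f) (w : Fibre G) : ∃ w', β (fib w) = fib w' := by
    obtain ⟨z, hzw, hz, hm⟩ := exists_eq_fib_iff.1 ⟨w, (rfl : (fib w : Realization f) = _)⟩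
    refine exists_eq_fib_iff.2 ⟨β z, β.monotone hzw, (hle_top β z).not.2 hz, ?_⟩
    rw [β.surjective.forall]
    intro m hmz hmin
    rw [hlt_u]
    exact hm m (β.le_iff_le.1 hmz) (β.isMin_apply.1 hmin)
  have hbase (β : Realization f ≃o Realization f) (y : Core H) : ∃ y', β (base y) = base y' := by
    rcases hx : β (base y) with y' | w
    · exact ⟨y', rfl⟩
    · obtain ⟨w', hw'⟩ := hfib β.symm w
      rw [← hx, β.symm_apply_apply] at hw'
      simp at hw'
  choose p hp using hbase α
  choose p' hp' using hbase α.symm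
  choose q hq using hfib α
  choose q' hq' using hfib α.symm
  let αY : Core H ≃o Core H :=
    { toFun := p
      invFun := p'
      left_inv y := base.inj (r := attach f) (by rw [← hp', ← hp, α.symm_apply_apply])
      right_inv y := base.inj (r := attach f) (by rw [← hp, ← hp', α.apply_symm_apply])
      map_rel_iff' := by
        intro x y
        have := α.le_iff_le (x := base x) (y := base y)
        rwa [hp, hp] at this }
  let αW : Fibre G ≃o Fibre G :=
    { toFun := q
      invFun := q'
      left_inv y := fib.inj (r := attach f) (by rw [← hq', ← hq, α.symm_apply_apply])
      right_inv y := fib.inj (r := attach f) (by rw [← hq, ← hq', α.apply_symm_apply])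
      map_rel_iff' := by
        intro x y
        have := α.le_iff_le (x := fib x) (y := fib y)
        rwa [hq, hq] at this }
  obtain ⟨h, hh⟩ := Core.exists_smul_of_orderIso αY
  obtain ⟨g, hg⟩ := Fibre.exists_smul_of_orderIso αW
  replace hh (y : Core H) : α (base y) = base (h • y) := (hp y).trans (congrArg base (hh y))
  replace hg (w : Fibre G) : α (fib w) = fib (g • w) := (hq w).trans (congrArg fib (hg w))
  have hfg : h = f g := by
    have h1 : (base (.l 1) : Realization f) ≤ fib (.a 1) := by simp
    rw [← α.le_iff_le, hh, hg] at h1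
    simpa [Core.le_def, Core.le] using h1
  refine ⟨g, ?_⟩
  rintro (y | w)
  · rw [hh, hfg, smul_base]
  · rw [hg, smul_fib]

end Realization

end Realization

/-- Every group homomorphism `f : G → H` is, up to isomorphisms `φ : G ≃ Aut(X)` and
`ψ : H ≃ ℰ(X)`, the natural map `τ : Aut(X) → ℰ(X)` of a `T₀` Alexandroff space `X`. -/
theorem mainTheorem1 {G : Type u} {H : Type v} [Group G] [Group H] (f : G →* H) :
    ∃ (X : Type (max u v)) (_ : TopologicalSpace X),
      T0Space X ∧ AlexandrovDiscrete X ∧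
        ∃ (φ : G ≃* (X ≃ₜ X)) (ψ : H ≃* SelfEquivClasses X),
          ∀ g : G, SelfEquivClasses.ofHomeomorph X (φ g) = ψ (f g) := by
  obtain ⟨_, _⟩ := exists_wellFoundedLT (α := G)
  obtain ⟨_, _⟩ := exists_wellFoundedLT (α := H)
  have hφ : Function.Bijective
      (Topology.IsUpperSet.smulHom (P := Realization f) Realization.smul_monotone) := by
    constructor
    · intro g g' h
      have h1 := DFunLike.congr_fun h (.fib (.a 1))
      have h2 : (Cyl.fib (.a (g * 1)) : Realization f) = .fib (.a (g' * 1)) := h1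
      simpa using h2
    · intro α
      obtain ⟨g, hg⟩ := Realization.exists_smul_of_orderIso
        (Topology.IsUpperSet.orderIsoOfHomeomorph α)
      exact ⟨g, Homeomorph.ext fun x => (hg x).symm⟩
  have hψ : Function.Bijective (Topology.IsUpperSet.smulHom (P := Core H) Core.smul_monotone) := by
    constructor
    · intro g g' h
      have h1 := DFunLike.congr_fun h (.v 1)
      have h2 : (Core.v (g * 1) : Core H) = .v (g' * 1) := h1
      simpa using h2
    · intro α
      obtain ⟨g, hg⟩ := Core.exists_smul_of_orderIso (Topology.IsUpperSet.orderIsoOfHomeomorph α)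
      exact ⟨g, Homeomorph.ext fun x => (hg x).symm⟩
  let i : HomotopyEquiv (Core H) (Realization f) := Cyl.homotopyEquivBase
  refine ⟨Realization f, inferInstance, Topology.IsUpperSet.t0Space, inferInstance,
    MulEquiv.ofBijective _ hφ,
    (MulEquiv.ofBijective _ hψ).trans ((MulEquiv.ofBijective _
      (SelfEquivClasses.ofHomeomorph_bijective fun _ => Core.eq_id_of_homotopic_id)).trans
      (SelfEquivClasses.congr i)), fun g => ?_⟩
  -- The inclusion `i` is equivariant along `f`, so conjugating the action of `f g` on the base by
  -- `i` gives the action of `g` precomposed with the retraction onto the base.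
  let a : C(Realization f, Realization f) := ⟨fun x => g • x,
    Topology.IsUpperSet.monotone_iff_continuous.1 (Realization.smul_monotone g)⟩
  exact (SelfEquivClasses.mk_eq_mk_iff _ _).2
    (Homotopic.comp (g₀ := a) (.refl a) i.right_inv).symm
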